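/- Let $(P,d)$ be a finite nonempty metric space whose points are called sites. A patrol schedule for $k$ robots of maximum speed $1$ specifies for each robot an infinite sequence of sites $s_0,s_1,\dots$ with arrival times $a_n$ and departure times $b_n$ such that $0\le a_0$, $a_n\le b_n$, $d(s_n,s_{n+1})\le a_{n+1}-b_n$ and $a_n\to\infty$; the robot is at $s_n$ during $[a_n,b_n]$, and a site is visited at time $t$ if some robot is at it at time $t$. The latency of a site is the supremum of $t_2-t_1$ over all $0\le t_1<t_2$ such that the site is not visited during $(t_1,t_2)$ (and $0$ if there are no such $t_1,t_2$), and the latency of a schedule is the maximum latency of its sites. A cyclic solution is a patrol schedule of the following form: $P$ is partitioned into nonempty groups $P_1,\dots,P_\ell$ with $\ell\le k$, each $P_i$ is assigned $k_i\ge 1$ robots with $\sum_{i=1}^{\ell} k_i=k$, and these $k_i$ robots, spaced evenly along a travelling salesman tour $T_i$ of $P_i$ (that is, at distance $\|T_i\|/k_i$ from each other along the tour), traverse $T_i$ forever at unit speed in the same direction; if $P_i$ is a single site, they stay there. A cyclic solution is an optimal cyclic solution if its latency is minimum among all cyclic solutions for $k$ robots on $P$. For $k=2$ robots, an optimal cyclic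 solution exists, and every optimal cyclic solution has minimum latency among all patrol schedules for two robots on $P$. -/

import Mathlib

open scoped ENNReal

namespace Patrol

/-- The timed itinerary of one robot of maximum speed `1` in the finite metric space `P`: an
infinite sequence of sites, together with the times at which the robot reaches and leaves the
successive sites of the sequence. The robot may wait at sites (`arrive n < depart n`), it may travel
more slowly than at unit speed, and it may be on its way to its first site at time `0`. -/
structure RobotSchedule (P : Type*) [MetricSpace P] where
  site : ℕ → P
  arrive : ℕ → ℝ
  depart : ℕ → ℝ
  arrive_zero_nonneg : 0 ≤ arrive 0
  arrive_le_depart : ∀ n, arrive n ≤ depart n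
  speed_le_one : ∀ n, dist (site n) (site (n + 1)) ≤ arrive (n + 1) - depart n
  tendsto_arrive : Filter.Tendsto arrive Filter.atTop Filter.atTop

/-- At time `t` the robot is at the site `s`. -/
def RobotSchedule.IsAt {P : Type*} [MetricSpace P] (f : RobotSchedule P) (t : ℝ) (s : P) : Prop :=
  ∃ n, f.site n = s ∧ f.arrive n ≤ t ∧ t ≤ f.depart n

/-- A patrol schedule for `k` robots. -/
abbrev PatrolSchedule (k : ℕ) (P : Type*) [MetricSpace P] := Fin k → RobotSchedule P

section Schedules

variable {k : ℕ} {P : Type*} [MetricSpace P]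

/-- The site `s` is visited by some robot at time `t`. -/
def Visited (σ : PatrolSchedule k P) (s : P) (t : ℝ) : Prop :=
  ∃ r, (σ r).IsAt t s

/-- The latency of a site: the supremum of the lengths of the time intervals (from time `0` on)
during which the site is not visited. It is `⊤` if the site is left unvisited from some time on, and
`0` if the site is never left unattended. -/
noncomputable def siteLatency (σ : PatrolSchedule k P) (s : P) : ℝ≥0∞ :=
  ⨆ (t₁ : ℝ) (t₂ : ℝ) (_ : 0 ≤ t₁) (_ : t₁ < t₂)
    (_ : ∀ t, t₁ < t → t < t₂ → ¬ Visited σ s t), ENNReal.ofReal (t₂ - t₁)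

/-- The latency of a patrol schedule: the maximum latency of its sites. -/
noncomputable def latency (σ : PatrolSchedule k P) : ℝ≥0∞ :=
  ⨆ s, siteLatency σ s

/-- `σ` has minimum latency among all patrol schedules for the same number of robots. -/
def IsOptimal (σ : PatrolSchedule k P) : Prop :=
  ∀ τ : PatrolSchedule k P, latency σ ≤ latency τ

end Schedules

/-- A closed tour that visits each element of `A` exactly once per round, unrolled to a periodic
sequence: one round is `vertex 0, …, vertex (size - 1)`, followed by the return to `vertex 0`. -/
structure Tour {P : Type*} [MetricSpace P] (A : Set P) where
  size : ℕ
  size_pos : 0 < size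
  vertex : ℕ → P
  periodic : ∀ n, vertex (n + size) = vertex n
  bijOn : Set.BijOn vertex (Set.Iio size) A

namespace Tour

variable {P : Type*} [MetricSpace P] {A : Set P}

/-- The distance travelled along the (unrolled) tour from `vertex 0` to `vertex n`. -/
noncomputable def dist₀ (T : Tour A) (n : ℕ) : ℝ :=
  ∑ i ∈ Finset.range n, dist (T.vertex i) (T.vertex (i + 1))

/-- The length of one round of the tour. -/
noncomputable def length (T : Tour A) : ℝ := T.dist₀ T.size

/-- `T` is a travelling salesman tour of `A`. -/
def IsTSP (T : Tour A) : Prop := ∀ T' : Tour A, T.length ≤ T'.length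

/-- The point of the closed tour that is reached from `vertex 0` after travelling the distance `x`
(taken modulo the length of the tour) is the site `s`. A tour of length `0` has only one point, and
every `x` describes this point. -/
def PointIs (T : Tour A) (x : ℝ) (s : P) : Prop :=
  ∃ n : ℕ, T.vertex n = s ∧ (T.length = 0 ∨ ∃ q : ℤ, x = T.dist₀ n + q * T.length)

end Tour

/-- The data of a cyclic solution for `k` robots: a partition of the sites into nonempty groups,
a nonempty team of robots for each group (every robot is in exactly one team, so there are at most
`k` groups and the team sizes add up to `k`), a travelling salesman tour of each group, an
enumeration `index` of the robots in each team by `0, …, teamSize - 1`, and the point of the tour,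
given by the distance travelled from its first vertex, at which robot number `0` starts. -/
structure CyclicPlan (k : ℕ) (P : Type*) [MetricSpace P] where
  numGroups : ℕ
  group : P → Fin numGroups
  group_surjective : Function.Surjective group
  team : Fin k → Fin numGroups
  team_surjective : Function.Surjective team
  tour : ∀ i, Tour {s | group s = i}
  tour_isTSP : ∀ i, (tour i).IsTSP
  index : Fin k → ℕ
  index_bijOn : ∀ i, Set.BijOn index {r | team r = i} (Set.Iio {r | team r = i}.ncard)
  start : Fin numGroups → ℝ

section Cyclic

variable {k : ℕ} {P : Type*} [MetricSpace P]

/-- The number of robots assigned to the group `i`. -/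
noncomputable def CyclicPlan.teamSize (C : CyclicPlan k P) (i : Fin C.numGroups) : ℕ :=
  {r | C.team r = i}.ncard

/-- The starting point of robot `r` on its tour: the robots of a team are spaced evenly, at distance
`length / teamSize` along the tour. -/
noncomputable def CyclicPlan.offset (C : CyclicPlan k P) (r : Fin k) : ℝ :=
  C.start (C.team r) + C.index r * ((C.tour (C.team r)).length / C.teamSize (C.team r))

/-- A cyclic solution: a patrol schedule in which the sites are partitioned into groups and the
robots of each team, evenly spaced, traverse a travelling salesman tour of their group at unit
speed. (Robots of a team whose group is a single site stay at this site.) -/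
def IsCyclic (σ : PatrolSchedule k P) : Prop :=
  ∃ C : CyclicPlan k P, ∀ (r : Fin k) (t : ℝ) (s : P), 0 ≤ t →
    ((σ r).IsAt t s ↔ (C.tour (C.team r)).PointIs (C.offset r + t) s)

/-- `σ` is a cyclic solution of minimum latency among all cyclic solutions. -/
def IsOptimalCyclic (σ : PatrolSchedule k P) : Prop :=
  IsCyclic σ ∧ ∀ σ' : PatrolSchedule k P, IsCyclic σ' → latency σ ≤ latency σ'

end Cyclic

end Patrol

/-! Cyclic solutions suffice once every schedule of finite latency `L` yields either one tour of all
sites of length at most `2 * L`, or a split of the sites into two groups with tours of length at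
most `L` (`exists_tours_of_visits`). Two robots evenly spaced on the first tour, or one robot on
each of the other two, then have latency at most `L`.

To find the tours, fix a time `t ≥ L`. Each site has visits `u ≤ t ≤ v` with `v - u ≤ L`; label the
interval `[u, v]` by the robots making the two visits. Two intervals labelled `(0,0)` and `(1,1)`
give a closed walk of each robot. Two intervals labelled `(0,1)` and `(1,0)` make the robots
exchange sites, so that their walks join into one closed walk of length at most `2 * L`. A
combinatorial choice (`exists_covering_pair`) finds a pair of one of these kinds whose walks meet
every site, provided that the labels `(0,1)` and `(1,0)` are both available at `t` or both
unavailable. Connectedness of `[L, ∞)` supplies such a `t` (`exists_bridges_iff`).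

There are finitely many groupings, so a best one exists. Cyclic solutions need only an upper bound
on their latency: the matching lower bound is the one for arbitrary schedules. -/

namespace Patrol

/-! ### Tours: unrolled distances, traversal by a robot, existence of shortest tours. -/

namespace Tour

variable {P : Type*} [MetricSpace P] {A : Set P}

lemma dist₀_monotone (T : Tour A) : Monotone T.dist₀ :=
  monotone_nat_of_le_succ fun n => by
    simp only [dist₀, Finset.sum_range_succ]
    linarith [dist_nonneg (x := T.vertex n) (y := T.vertex (n + 1))]

lemma length_nonneg (T : Tour A) : 0 ≤ T.length := by
  unfold length dist₀
  positivity

lemma dist_vertex_le (T : Tour A) {m n : ℕ} (h : m ≤ n) :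
    dist (T.vertex m) (T.vertex n) ≤ T.dist₀ n - T.dist₀ m := by
  induction n, h using Nat.le_induction with
  | base => simp
  | succ n _ ih =>
    have := dist_triangle (T.vertex m) (T.vertex n) (T.vertex (n + 1))
    simp only [dist₀, Finset.sum_range_succ] at ih ⊢
    linarith

lemma dist₀_add_size (T : Tour A) (n : ℕ) : T.dist₀ (n + T.size) = T.dist₀ n + T.length := by
  induction n with
  | zero => simp [dist₀, length]
  | succ n ih =>
    have h : n + 1 + T.size = (n + T.size) + 1 := by omega
    have h' : T.vertex (n + T.size + 1) = T.vertex (n + 1) := by rw [← h, T.periodic]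
    rw [h]
    simp only [dist₀, Finset.sum_range_succ] at ih ⊢
    rw [ih, T.periodic, h']
    ring

lemma vertex_add_mul_size (T : Tour A) (n q : ℕ) : T.vertex (n + q * T.size) = T.vertex n := by
  induction q with
  | zero => simp
  | succ q ih => rw [Nat.succ_mul, ← add_assoc, T.periodic, ih]

lemma dist₀_add_mul_size (T : Tour A) (n q : ℕ) :
    T.dist₀ (n + q * T.size) = T.dist₀ n + q * T.length := by
  induction q with
  | zero => simp
  | succ q ih =>
    rw [Nat.succ_mul, ← add_assoc, T.dist₀_add_size, ih]
    push_cast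
    ring

/-- A point of the tour at nonnegative distance is reached after finitely many steps. -/
lemma exists_dist₀_eq (T : Tour A) (n : ℕ) (q : ℤ) (h : 0 ≤ T.dist₀ n + q * T.length) :
    ∃ m, T.vertex m = T.vertex n ∧ T.dist₀ m = T.dist₀ n + q * T.length := by
  induction n using Nat.strong_induction_on generalizing q with
  | _ n ih =>
    rcases le_or_gt 0 q with hq | hq
    · lift q to ℕ using hq
      exact ⟨n + q * T.size, T.vertex_add_mul_size n q, by simp [T.dist₀_add_mul_size]⟩
    rcases le_or_gt T.size n with hn | hn
    · obtain ⟨m, rfl⟩ := Nat.exists_eq_add_of_le' hn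
      have e : T.dist₀ (m + T.size) + q * T.length
          = T.dist₀ m + ((q + 1 : ℤ) : ℝ) * T.length := by
        rw [T.dist₀_add_size]; push_cast; ring
      rw [e] at h ⊢
      rw [T.periodic]
      exact ih m (by have := T.size_pos; omega) (q + 1) h
    · have h1 : T.dist₀ n ≤ T.length := T.dist₀_monotone hn.le
      have h2 : (q : ℝ) ≤ -1 := by exact_mod_cast Int.le_sub_one_of_lt hq
      have h3 : (q : ℝ) * T.length ≤ -1 * T.length :=
        mul_le_mul_of_nonneg_right h2 T.length_nonneg
      have h4 := T.dist_vertex_le hn.le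
      have h5 : T.vertex n = T.vertex T.size := by
        -- Here `n < size` and `q ≤ -1`, so nonnegativity of `dist₀ n + q * length` forces `dist₀ n
        -- = length`. The rest of the round has length zero, and index `0` serves as `m`.
        refine dist_le_zero.1 (h4.trans ?_)
        change T.length - _ ≤ 0
        linarith
      refine ⟨0, ?_, ?_⟩
      · rw [h5]
        simpa using (T.periodic 0).symm
      · simp only [dist₀, Finset.range_zero, Finset.sum_empty] at *
        linarith

lemma tendsto_dist₀ (T : Tour A) (h : 0 < T.length) :
    Filter.Tendsto T.dist₀ Filter.atTop Filter.atTop := by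
  refine Filter.tendsto_atTop_atTop_of_monotone T.dist₀_monotone fun b => ?_
  obtain ⟨q, hq⟩ := exists_nat_ge (b / T.length)
  refine ⟨0 + q * T.size, ?_⟩
  rw [T.dist₀_add_mul_size]
  simpa [dist₀] using (div_le_iff₀ h).1 hq

lemma vertex_mem (T : Tour A) (n : ℕ) : T.vertex n ∈ A := by
  have := T.vertex_add_mul_size (n % T.size) (n / T.size)
  rw [Nat.mod_add_div'] at this
  rw [this]
  exact T.bijOn.mapsTo (Nat.mod_lt _ T.size_pos)

lemma nonempty (T : Tour A) : A.Nonempty := ⟨_, T.vertex_mem 0⟩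

lemma ncard_eq_size (T : Tour A) : A.ncard = T.size := by
  have h := T.bijOn.injOn.ncard_image
  rw [T.bijOn.image_eq] at h
  rw [h, ← Finset.coe_Iio, Set.ncard_coe_finset, Nat.card_Iio]

lemma vertex_eq_vertex_zero (T : Tour A) (h : T.length = 0) (n : ℕ) :
    T.vertex n = T.vertex 0 := by
  have h2 : T.dist₀ (n % T.size) ≤ T.length := T.dist₀_monotone (Nat.mod_lt _ T.size_pos).le
  have h3 := T.dist_vertex_le (Nat.zero_le (n % T.size))
  have h4 := T.vertex_add_mul_size (n % T.size) (n / T.size)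
  rw [Nat.mod_add_div'] at h4
  rw [h4]
  refine (dist_le_zero.1 (h3.trans ?_)).symm
  simp only [dist₀, Finset.range_zero, Finset.sum_empty] at h2 ⊢
  linarith

/-- A robot that starts at distance `x` along the tour and traverses it at unit speed. -/
lemma exists_robotSchedule (T : Tour A) {x : ℝ} (hx : 0 ≤ x) :
    ∃ R : RobotSchedule P, ∀ (t : ℝ) (s : P), 0 ≤ t →
      (R.IsAt t s ↔ T.PointIs (x + t) s) := by
  rcases T.length_nonneg.eq_or_lt' with h0 | hpos
  · refine ⟨⟨fun _ => T.vertex 0, fun n => n, fun n => n + 1, by simp, by simp, by simp,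
      tendsto_natCast_atTop_atTop⟩, fun t s ht => ⟨?_, ?_⟩⟩
    · rintro ⟨n, hn, -⟩
      exact ⟨0, hn, Or.inl h0⟩
    · rintro ⟨n, hn, -⟩
      exact ⟨⌊t⌋₊, (T.vertex_eq_vertex_zero h0 n).symm.trans hn, Nat.floor_le ht,
        (Nat.lt_floor_add_one t).le⟩
  · classical
    have hex : ∃ n, x ≤ T.dist₀ n :=
      ((T.tendsto_dist₀ hpos).eventually_ge_atTop x).exists
    -- The robot first heads for the first vertex at distance at least `x`. Minimality of `m`
    -- ensures that no visit at a nonnegative time is lost.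
    set m := Nat.find hex with hm
    have hmx : x ≤ T.dist₀ m := Nat.find_spec hex
    refine ⟨⟨fun n => T.vertex (n + m), fun n => T.dist₀ (n + m) - x,
      fun n => T.dist₀ (n + m) - x, by simpa using hmx, fun n => le_rfl, fun n => ?_, ?_⟩,
      fun t s ht => ⟨?_, ?_⟩⟩
    · have := T.dist_vertex_le (Nat.le_add_right (n + m) 1)
      rw [show n + 1 + m = n + m + 1 by omega]
      linarith
    · exact Filter.tendsto_atTop_add_const_right _ _
        ((T.tendsto_dist₀ hpos).comp (Filter.tendsto_add_atTop_nat m))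
    · rintro ⟨n, hn, h1, h2⟩
      refine ⟨n + m, hn, Or.inr ⟨0, ?_⟩⟩
      simp only at h1 h2
      push_cast
      linarith
    · rintro ⟨n, hn, h | ⟨q, hq⟩⟩
      · exact absurd h hpos.ne'
      obtain ⟨l, hl, hl'⟩ := T.exists_dist₀_eq n q (by linarith)
      have hml : m ≤ l := Nat.find_min' hex (by linarith)
      obtain ⟨p, rfl⟩ := Nat.exists_eq_add_of_le' hml
      exact ⟨p, hl.trans hn, by simp only; linarith, by simp only; linarith⟩

/-- A map to the circle of length `C` that does not decrease distances yields a tour of length at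
most `C`. -/
lemma exists_length_le [Finite P] (hA : A.Nonempty) (τ : P → ℝ) (C : ℝ)
    (h₁ : ∀ x ∈ A, ∀ y ∈ A, τ x ≤ τ y → dist x y ≤ τ y - τ x)
    (h₂ : ∀ x ∈ A, ∀ y ∈ A, τ x ≤ τ y → dist x y ≤ C - (τ y - τ x)) :
    ∃ T : Tour A, T.length ≤ C := by
  classical
  obtain ⟨N, ⟨e₀⟩⟩ := Finite.exists_equiv_fin A
  obtain ⟨M, rfl⟩ : ∃ M, N = M + 1 := by
    obtain ⟨a, ha⟩ := hA
    have := (e₀ ⟨a, ha⟩).pos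
    exact ⟨N - 1, by omega⟩
  -- The tour visits the elements of `A` in increasing order of `τ`. The bounds `h₁` telescope from
  -- the first element to the last, and `h₂` pays for the return.
  let g : Fin (M + 1) → ℝ := fun i => τ (e₀.symm i)
  let e : Fin (M + 1) ≃ A := (Tuple.sort g).trans e₀.symm
  have he : Monotone fun i => τ (e i) := Tuple.monotone_sort g
  let w : ℕ → P := fun n => e (Fin.ofNat (M + 1) n)
  have hw : ∀ n, w n ∈ A := fun n => (e _).2
  have hper : ∀ n, w (n + (M + 1)) = w n := fun n => by
    simp only [w]
    congr 2
    ext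
    simp
  have hval : ∀ n, n < M + 1 → ((Fin.ofNat (M + 1) n : Fin (M + 1)) : ℕ) = n := fun n hn => by
    simp [Nat.mod_eq_of_lt hn]
  have hmono : ∀ m n, m ≤ n → n < M + 1 → τ (w m) ≤ τ (w n) := fun m n hmn hn => by
    apply he
    rw [Fin.le_def, hval m (by omega), hval n hn]
    exact hmn
  refine ⟨⟨M + 1, by omega, w, hper, fun n _ => hw n, ?_, ?_⟩, ?_⟩
  · intro m hm n hn hmn
    have := congrArg Fin.val (e.injective (Subtype.ext hmn))
    rwa [hval m hm, hval n hn] at this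
  · intro a ha
    refine ⟨(e.symm ⟨a, ha⟩ : Fin (M + 1)), (e.symm ⟨a, ha⟩).2, ?_⟩
    simp [w]
  · have hsum : ∑ i ∈ Finset.range M, dist (w i) (w (i + 1)) ≤ τ (w M) - τ (w 0) := by
      rw [← Finset.sum_range_sub (fun i => τ (w i)) M]
      refine Finset.sum_le_sum fun i hi => ?_
      have := Finset.mem_range.1 hi
      exact h₁ _ (hw _) _ (hw _) (hmono _ _ (by omega) (by omega))
    have hlast := h₂ _ (hw 0) _ (hw M) (hmono 0 M (by omega) (by omega))
    have hwM : w (M + 1) = w 0 := by simpa using hper 0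
    change ∑ i ∈ Finset.range (M + 1), dist (w i) (w (i + 1)) ≤ C
    rw [Finset.sum_range_succ, hwM, dist_comm (w M)]
    linarith

/-- The length depends only on the first `A.ncard + 1` vertices, and there are finitely many such
tuples. -/
lemma finite_range_length [Finite P] (A : Set P) :
    (Set.range (length : Tour A → ℝ)).Finite := by
  refine (Set.finite_range fun f : Fin (A.ncard + 1) → P =>
    ∑ i : Fin A.ncard, dist (f i.castSucc) (f i.succ)).subset ?_
  rintro _ ⟨T, rfl⟩
  refine ⟨fun i => T.vertex i, ?_⟩
  simp only [length, dist₀, Fin.val_castSucc, Fin.val_succ]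
  rw [Fin.sum_univ_eq_sum_range (fun i => dist (T.vertex i) (T.vertex (i + 1))), T.ncard_eq_size]

lemma exists_isTSP [Finite P] (hA : A.Nonempty) : ∃ T : Tour A, T.IsTSP := by
  have hne : Nonempty (Tour A) := by
    obtain ⟨N, ⟨e⟩⟩ := Finite.exists_equiv_fin P
    obtain ⟨D, hD⟩ := (Set.finite_range fun p : P × P => dist p.1 p.2).bddAbove
    have hD' : ∀ x y, dist x y ≤ D := fun x y => hD ⟨(x, y), rfl⟩
    have hD0 : 0 ≤ D := dist_nonneg.trans (hD' hA.some hA.some)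
    have key : ∀ x y, D * (e x : ℕ) ≤ D * (e y : ℕ) →
        dist x y ≤ D * (e y : ℕ) - D * (e x : ℕ) := by
      intro x y hxy
      rcases eq_or_ne x y with rfl | hne
      · simp
      rcases hD0.eq_or_lt with h0 | hpos
      · exact absurd (dist_le_zero.1 (h0 ▸ hD' x y)) hne
      have h1 : (e x : ℕ) ≤ e y := by exact_mod_cast le_of_mul_le_mul_left hxy hpos
      have h2 : (e x : ℕ) ≠ e y := fun h => hne (e.injective (Fin.ext h))
      have h3 : ((e x : ℕ) : ℝ) + 1 ≤ (e y : ℕ) := by exact_mod_cast lt_of_le_of_ne h1 h2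
      nlinarith [hD' x y]
    -- Some tour exists: place the points on a circle with gaps of at least the largest distance
    -- `D`.
    obtain ⟨T, -⟩ := exists_length_le hA (fun x => D * (e x : ℕ)) (D * N + D)
      (fun x _ y _ => key x y) (fun x _ y _ _ => by
        have h1 : ((e y : ℕ) : ℝ) ≤ N := by exact_mod_cast (e y).2.le
        have h2 : (0 : ℝ) ≤ (e x : ℕ) := by positivity
        nlinarith [hD' x y])
    exact ⟨T⟩
  obtain ⟨_, ⟨T, rfl⟩, hT⟩ := Set.exists_min_image _ id (finite_range_length A)
    (Set.range_nonempty _)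
  exact ⟨T, fun T' => hT _ ⟨T', rfl⟩⟩

end Tour

/-! ### Latency of cyclic solutions. -/

/-- The length of a travelling salesman tour of `A`. -/
noncomputable def tspLength {P : Type*} [MetricSpace P] (A : Set P) : ℝ := ⨅ T : Tour A, T.length

section

variable {P : Type*} [MetricSpace P] {A : Set P}

lemma tspLength_le (T : Tour A) : tspLength A ≤ T.length :=
  ciInf_le ⟨0, by rintro _ ⟨T, rfl⟩; exact T.length_nonneg⟩ T

lemma Tour.IsTSP.length_le {T : Tour A} (hT : T.IsTSP) : T.length ≤ tspLength A :=
  have : Nonempty (Tour A) := ⟨T⟩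
  le_ciInf hT

variable {k : ℕ}

lemma CyclicPlan.exists_schedule (C : CyclicPlan k P) (h : ∀ r, 0 ≤ C.offset r) :
    ∃ σ : PatrolSchedule k P, ∀ (r : Fin k) (t : ℝ) (s : P), 0 ≤ t →
      ((σ r).IsAt t s ↔ (C.tour (C.team r)).PointIs (C.offset r + t) s) := by
  choose σ hσ using fun r => (C.tour (C.team r)).exists_robotSchedule (h r)
  exact ⟨σ, hσ⟩

lemma CyclicPlan.teamSize_pos (C : CyclicPlan k P) (i : Fin C.numGroups) : 0 < C.teamSize i := by
  rw [CyclicPlan.teamSize, Set.ncard_pos]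
  exact C.team_surjective i

/-- Even spacing makes the team reach each site at all nonnegative times of an arithmetic
progression with difference `length / teamSize`. -/
lemma CyclicPlan.latency_le (C : CyclicPlan k P) {σ : PatrolSchedule k P}
    (hσ : ∀ (r : Fin k) (t : ℝ) (s : P), 0 ≤ t →
      ((σ r).IsAt t s ↔ (C.tour (C.team r)).PointIs (C.offset r + t) s))
    {Λ : ℝ} (hΛ : ∀ i, (C.tour i).length / C.teamSize i ≤ Λ) :
    latency σ ≤ ENNReal.ofReal Λ := by
  refine iSup_le fun s => iSup_le fun t₁ => iSup_le fun t₂ => iSup_le fun h₀ => iSup_le fun h₁₂ =>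
    iSup_le fun hv => ENNReal.ofReal_le_ofReal ?_
  by_contra! hlt
  set i := C.group s with hi
  have hK := C.teamSize_pos i
  have hK' : (0 : ℝ) < C.teamSize i := by exact_mod_cast hK
  obtain ⟨n, -, hn⟩ := (C.tour i).bijOn.surjOn (show s ∈ {s | C.group s = i} from rfl)
  rcases (C.tour i).length_nonneg.eq_or_lt' with hl0 | hlpos
  · obtain ⟨r, hr⟩ := C.team_surjective i
    refine hv ((t₁ + t₂) / 2) (by linarith) (by linarith) ⟨r, ?_⟩
    rw [hσ r _ s (by linarith), hr]
    exact ⟨n, hn, Or.inl hl0⟩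
  · set h := (C.tour i).length / C.teamSize i with hh
    have hpos : 0 < h := div_pos hlpos hK'
    -- The time `dist₀ n - start + m * h` lies in `(t₁, t₁ + h]`. The robot at the site then is the
    -- one whose index is `-m` modulo the team size.
    obtain ⟨m, ⟨hm1, hm2⟩, -⟩ :=
      existsUnique_add_zsmul_mem_Ioc hpos ((C.tour i).dist₀ n - C.start i) t₁
    have hKZ : (0 : ℤ) < C.teamSize i := by exact_mod_cast hK
    obtain ⟨r, hr, hri⟩ := (C.index_bijOn i).surjOn
      (show ((-m) % (C.teamSize i : ℤ)).toNat ∈ Set.Iio (C.teamSize i) from by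
        have := Int.emod_lt_of_pos (-m) hKZ
        have := Int.emod_nonneg (-m) hKZ.ne'
        simp only [Set.mem_Iio]
        omega)
    have hr : C.team r = i := hr
    have hidx : (C.index r : ℤ) = (-m) % (C.teamSize i : ℤ) := by
      rw [hri, Int.toNat_of_nonneg (Int.emod_nonneg _ hKZ.ne')]
    have hidx' : (C.index r : ℤ) + m = -((-m) / (C.teamSize i : ℤ)) * C.teamSize i := by
      have := Int.emod_add_mul_ediv (-m) (C.teamSize i : ℤ)
      linarith
    have hidx'' : (C.index r : ℝ) + m = (-((-m) / (C.teamSize i : ℤ)) : ℤ) * C.teamSize i := by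
      exact_mod_cast hidx'
    rw [zsmul_eq_mul] at hm1 hm2
    refine hv _ hm1 (lt_of_le_of_lt hm2 (by linarith [hΛ i])) ⟨r, ?_⟩
    rw [hσ r _ s (by linarith), CyclicPlan.offset, hr]
    refine ⟨n, hn, Or.inr ⟨-((-m) / (C.teamSize i : ℤ)), ?_⟩⟩
    have e : (C.tour i).length = C.teamSize i * h := by
      rw [hh]; field_simp
    rw [← hh, e, ← mul_assoc, ← hidx'']
    ring

lemma exists_cyclic_of_group [Finite P] {m : ℕ} (group : P → Fin m)
    (hgroup : Function.Surjective group) (team : Fin k → Fin m)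
    (hteam : Function.Surjective team) (index : Fin k → ℕ)
    (hindex : ∀ i, Set.BijOn index {r | team r = i} (Set.Iio {r | team r = i}.ncard))
    {Λ : ℝ} (hΛ : ∀ i, tspLength {s | group s = i} / {r | team r = i}.ncard ≤ Λ) :
    ∃ σ : PatrolSchedule k P, IsCyclic σ ∧ latency σ ≤ ENNReal.ofReal Λ := by
  choose T hT using fun i => Tour.exists_isTSP (A := {s | group s = i}) (hgroup i)
  let C : CyclicPlan k P := ⟨m, group, hgroup, team, hteam, T, hT, index, hindex, fun _ => 0⟩
  obtain ⟨σ, hσ⟩ := C.exists_schedule fun r => by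
    have := (C.tour (C.team r)).length_nonneg
    simp only [CyclicPlan.offset]
    positivity
  refine ⟨σ, ⟨C, hσ⟩, C.latency_le hσ fun i => le_trans ?_ (hΛ i)⟩
  exact div_le_div_of_nonneg_right (hT i).length_le (Nat.cast_nonneg _)

lemma exists_cyclic_one_group [Finite P] [Nonempty P] :
    ∃ σ : PatrolSchedule 2 P,
      IsCyclic σ ∧ latency σ ≤ ENNReal.ofReal (tspLength (Set.univ : Set P) / 2) := by
  have h1 : ∀ i : Fin 1, {r : Fin 2 | (fun _ => 0 : Fin 2 → Fin 1) r = i} = Set.univ :=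
    fun i => by ext; simp [Subsingleton.elim i 0]
  refine exists_cyclic_of_group (m := 1) (fun _ => 0) (fun i => ?_) (fun _ => 0) (fun i => ?_)
    (fun r => r) (fun i => ?_) fun i => ?_
  · exact ⟨Classical.arbitrary P, Subsingleton.elim _ _⟩
  · exact ⟨0, Subsingleton.elim _ _⟩
  · rw [h1]
    refine ⟨fun r _ => by simpa [Set.ncard_univ] using r.2, Fin.val_injective.injOn, ?_⟩
    intro n hn
    simp only [Set.ncard_univ, Nat.card_eq_fintype_card, Fintype.card_fin, Set.mem_Iio] at hn
    exact ⟨⟨n, hn⟩, trivial, rfl⟩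
  · have h2 : {s : P | (fun _ => 0 : P → Fin 1) s = i} = Set.univ := by
      ext; simp [Subsingleton.elim i 0]
    rw [h1, h2]
    simp [Set.ncard_univ]

lemma exists_cyclic_two_groups [Finite P] (hA : A.Nonempty) (hA' : Aᶜ.Nonempty) :
    ∃ σ : PatrolSchedule 2 P,
      IsCyclic σ ∧ latency σ ≤ ENNReal.ofReal (max (tspLength A) (tspLength Aᶜ)) := by
  classical
  obtain ⟨a, ha⟩ := hA
  obtain ⟨b, hb⟩ := hA'
  have h1 : ∀ i : Fin 2, {r : Fin 2 | id r = i} = {i} := fun i => by ext; simp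
  refine exists_cyclic_of_group (m := 2) (fun s => if s ∈ A then 0 else 1) (fun i => ?_) id
    Function.surjective_id (fun _ => 0) (fun i => ?_) fun i => ?_
  · fin_cases i
    · exact ⟨a, by simp [ha]⟩
    · exact ⟨b, by simpa using hb⟩
  · rw [h1, Set.ncard_singleton]
    refine ⟨fun r _ => by simp, by simp, fun n hn => ⟨i, rfl, ?_⟩⟩
    exact (Nat.lt_one_iff.1 hn).symm
  · rw [h1, Set.ncard_singleton]
    fin_cases i
    · simp
    · simp [← Set.compl_def]

end

end Patrol

/-! ### Visits in an arbitrary schedule. -/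

namespace Patrol

section Robot

variable {P : Type*} [MetricSpace P]

lemma RobotSchedule.dist_site_le (f : RobotSchedule P) {m n : ℕ} (h : m < n) :
    dist (f.site m) (f.site n) ≤ f.arrive n - f.depart m := by
  induction n, h using Nat.le_induction with
  | base => exact f.speed_le_one m
  | succ n _ ih =>
    have := dist_triangle (f.site m) (f.site n) (f.site (n + 1))
    linarith [f.speed_le_one n, f.arrive_le_depart n]

lemma RobotSchedule.IsAt.dist_le {f : RobotSchedule P} {u v : ℝ} {s s' : P}
    (hu : f.IsAt u s) (hv : f.IsAt v s') (huv : u ≤ v) : dist s s' ≤ v - u := by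
  obtain ⟨m, rfl, h1, h2⟩ := hu
  obtain ⟨n, rfl, h3, h4⟩ := hv
  rcases lt_trichotomy m n with h | rfl | h
  · linarith [f.dist_site_le h]
  · simpa using huv
  · rw [dist_comm]
    linarith [f.dist_site_le h]

lemma RobotSchedule.isClosed_isAt (f : RobotSchedule P) (s : P) :
    IsClosed {t | f.IsAt t s} := by
  have e : {t | f.IsAt t s} = ⋃ n, {t | f.site n = s ∧ f.arrive n ≤ t ∧ t ≤ f.depart n} := by
    ext t
    simp [RobotSchedule.IsAt]
  rw [e]
  -- Since arrival times tend to infinity, only finitely many stays begin before time `x + 1`.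
  refine LocallyFinite.isClosed_iUnion (fun x => ⟨Set.Iio (x + 1), Iio_mem_nhds (by linarith), ?_⟩)
    fun n => ?_
  · have h := f.tendsto_arrive.eventually_ge_atTop (x + 1)
    rw [← Nat.cofinite_eq_atTop] at h
    refine Set.Finite.subset h ?_
    rintro n ⟨t, ⟨-, h1, -⟩, h2⟩ h3
    exact absurd h2 (not_lt.2 (h3.trans h1))
  · by_cases hn : f.site n = s
    · simp only [hn, true_and]
      exact isClosed_Icc (a := f.arrive n) (b := f.depart n)
    · simp [hn]

/-- Visit times form a closed set, so a closed window of length `L` without visits would extend to a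
strictly longer gap. -/
lemma exists_visited_mem_Icc {k : ℕ} {τ : PatrolSchedule k P} {L : ℝ} (hL : 0 ≤ L)
    (h : latency τ ≤ ENNReal.ofReal L) (s : P) {c : ℝ} (hc : 0 ≤ c) :
    ∃ t ∈ Set.Icc c (c + L), Visited τ s t := by
  by_contra! hno
  have hcl : IsClosed {t | Visited τ s t} := by
    have : {t | Visited τ s t} = ⋃ r, {t | (τ r).IsAt t s} := by ext; simp [Visited]
    rw [this]
    exact isClosed_iUnion_of_finite fun r => (τ r).isClosed_isAt s
  obtain ⟨ε, hε, hball⟩ := Metric.isOpen_iff.1 hcl.isOpen_compl (c + L)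
    (hno _ ⟨by linarith, le_rfl⟩)
  have key : ENNReal.ofReal (c + L + ε - c) ≤ siteLatency τ s := by
    refine le_iSup_of_le c (le_iSup_of_le (c + L + ε) (le_iSup_of_le hc (le_iSup_of_le
      (by linarith) (le_iSup_of_le (fun t h1 h2 => ?_) le_rfl))))
    rcases le_or_gt t (c + L) with ht | ht
    · exact hno t ⟨h1.le, ht⟩
    · apply hball
      rw [Metric.mem_ball, Real.dist_eq, abs_of_pos (by linarith)]
      linarith
  have h2 := (key.trans (le_iSup (siteLatency τ) s)).trans h
  rw [ENNReal.ofReal_le_ofReal_iff hL] at h2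
  linarith

end Robot

/-! ### Choice of a covering pair of intervals. -/

/-- Among four finite families of intervals, indexed by the robots that visit a site at the left and
at the right end, one can choose a pair of intervals with matching labels that leaves no interval
uncovered at both ends: here under the assumption that some interval of `G₁₁` starts no later than
all those of `G₁₂`. -/
lemma exists_covering_pair_of_le {G₁₁ G₁₂ G₂₁ G₂₂ : Set (ℝ × ℝ)}
    (f₁₁ : G₁₁.Finite) (f₂₁ : G₂₁.Finite)
    {s₀ z p : ℝ × ℝ} (hs₀ : s₀ ∈ G₁₁) (hz : z ∈ G₁₂) (hp : p ∈ G₂₂)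
    (hzmin : ∀ g ∈ G₁₂, z.1 ≤ g.1) (hpmin : ∀ g ∈ G₂₂, p.1 ≤ g.1) (hle : s₀.1 ≤ z.1) :
    (∃ a ∈ G₁₁, ∃ b ∈ G₂₂, (∀ g ∈ G₁₁, a.1 ≤ g.1 ∨ g.2 ≤ a.2) ∧ (∀ g ∈ G₁₂, a.1 ≤ g.1 ∨ g.2 ≤ b.2) ∧
      (∀ g ∈ G₂₁, b.1 ≤ g.1 ∨ g.2 ≤ a.2) ∧ (∀ g ∈ G₂₂, b.1 ≤ g.1 ∨ g.2 ≤ b.2)) ∨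
    (∃ a ∈ G₁₂, ∃ b ∈ G₂₁, (∀ g ∈ G₁₂, a.1 ≤ g.1 ∨ g.2 ≤ a.2) ∧ (∀ g ∈ G₁₁, a.1 ≤ g.1 ∨ g.2 ≤ b.2) ∧
      (∀ g ∈ G₂₂, b.1 ≤ g.1 ∨ g.2 ≤ a.2) ∧ (∀ g ∈ G₂₁, b.1 ≤ g.1 ∨ g.2 ≤ b.2)) := by
  -- Among the intervals of `G₁₁` starting no later than `z`, the leftmost interval of `G₁₂`, take
  -- the one reaching farthest right. The pair `(s, p)` can then fail only on `G₂₁`.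
  obtain ⟨s, ⟨hs, hsz⟩, hsmax⟩ := Set.exists_max_image {g ∈ G₁₁ | g.1 ≤ z.1} Prod.snd
    (f₁₁.subset fun g hg => hg.1) ⟨s₀, hs₀, hle⟩
  by_cases hgood : ∀ g ∈ G₂₁, p.1 ≤ g.1 ∨ g.2 ≤ s.2
  · refine Or.inl ⟨s, hs, p, hp, fun g hg => ?_, fun g hg => Or.inl (hsz.trans (hzmin g hg)), hgood,
      fun g hg => Or.inl (hpmin g hg)⟩
    rcases le_total s.1 g.1 with h | h
    · exact Or.inl h
    · exact Or.inr (hsmax g ⟨hg, h.trans hsz⟩)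
  push Not at hgood
  obtain ⟨w₀, hw₀, hw₀p, hw₀s⟩ := hgood
  -- A failure on `G₂₁` provides an interval starting before `p` and ending after `s`. The farthest
  -- reaching `w` that starts no later than `p` therefore outlasts `s`, so `(z, w)` also covers
  -- those intervals of `G₁₁` that start before `z`.
  obtain ⟨w, ⟨hw, hwp⟩, hwmax⟩ := Set.exists_max_image {g ∈ G₂₁ | g.1 ≤ p.1} Prod.snd
    (f₂₁.subset fun g hg => hg.1) ⟨w₀, hw₀, hw₀p.le⟩
  have hws : s.2 < w.2 := hw₀s.trans_le (hwmax w₀ ⟨hw₀, hw₀p.le⟩)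
  refine Or.inr ⟨z, hz, w, hw, fun g hg => Or.inl (hzmin g hg), fun g hg => ?_,
    fun g hg => Or.inl (hwp.trans (hpmin g hg)), fun g hg => ?_⟩
  · rcases le_total z.1 g.1 with h | h
    · exact Or.inl h
    · exact Or.inr ((hsmax g ⟨hg, h⟩).trans hws.le)
  · rcases le_total w.1 g.1 with h | h
    · exact Or.inl h
    · exact Or.inr (hwmax g ⟨hg, h.trans hwp⟩)

lemma exists_covering_pair {G₁₁ G₁₂ G₂₁ G₂₂ : Set (ℝ × ℝ)}
    (f₁₁ : G₁₁.Finite) (f₁₂ : G₁₂.Finite) (f₂₁ : G₂₁.Finite) (f₂₂ : G₂₂.Finite)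
    (n₁₁ : G₁₁.Nonempty) (n₂₂ : G₂₂.Nonempty)
    (n : G₁₂.Nonempty ↔ G₂₁.Nonempty) :
    (∃ a ∈ G₁₁, ∃ b ∈ G₂₂, (∀ g ∈ G₁₁, a.1 ≤ g.1 ∨ g.2 ≤ a.2) ∧ (∀ g ∈ G₁₂, a.1 ≤ g.1 ∨ g.2 ≤ b.2) ∧
      (∀ g ∈ G₂₁, b.1 ≤ g.1 ∨ g.2 ≤ a.2) ∧ (∀ g ∈ G₂₂, b.1 ≤ g.1 ∨ g.2 ≤ b.2)) ∨
    (∃ a ∈ G₁₂, ∃ b ∈ G₂₁, (∀ g ∈ G₁₂, a.1 ≤ g.1 ∨ g.2 ≤ a.2) ∧ (∀ g ∈ G₁₁, a.1 ≤ g.1 ∨ g.2 ≤ b.2) ∧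
      (∀ g ∈ G₂₂, b.1 ≤ g.1 ∨ g.2 ≤ a.2) ∧ (∀ g ∈ G₂₁, b.1 ≤ g.1 ∨ g.2 ≤ b.2)) := by
  obtain ⟨s, hs, hsmin⟩ := Set.exists_min_image G₁₁ Prod.fst f₁₁ n₁₁
  obtain ⟨p, hp, hpmin⟩ := Set.exists_min_image G₂₂ Prod.fst f₂₂ n₂₂
  by_cases n₁₂ : G₁₂.Nonempty
  · obtain ⟨z, hz, hzmin⟩ := Set.exists_min_image G₁₂ Prod.fst f₁₂ n₁₂
    obtain ⟨w, hw, hwmin⟩ := Set.exists_min_image G₂₁ Prod.fst f₂₁ (n.1 n₁₂)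
    rcases le_total s.1 z.1 with h | h
    · exact exists_covering_pair_of_le f₁₁ f₂₁ hs hz hp hzmin hpmin h
    -- Swapping the labels of the right ends interchanges the two kinds of pairs.
    · exact (exists_covering_pair_of_le f₁₂ f₂₂ hz hs hw hsmin hwmin h).symm
  · have e₁₂ := Set.not_nonempty_iff_eq_empty.1 n₁₂
    have e₂₁ := Set.not_nonempty_iff_eq_empty.1 (n.not.1 n₁₂)
    exact Or.inl ⟨s, hs, p, hp, fun g hg => Or.inl (hsmin g hg), by simp [e₁₂], by simp [e₂₁],
      fun g hg => Or.inl (hpmin g hg)⟩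

/-! ### Choice of the time `t`. -/

section Visits

variable {P : Type*}

/-- Some site is visited by robot `i` at a time `u ≤ t` and by robot `j` at a time `v ≥ t`, with
`v - u ≤ L`. -/
def Bridges (V : Fin 2 → P → Set ℝ) (L : ℝ) (i j : Fin 2) (t : ℝ) : Prop :=
  ∃ s, ∃ u ∈ V i s, ∃ v ∈ V j s, u ≤ t ∧ t ≤ v ∧ v ≤ u + L

variable {V : Fin 2 → P → Set ℝ} {L : ℝ}

/-- The delays `t - u` and `v - t` range over the compact interval `[0, L]`, and projection along a
compact factor preserves closedness. -/
lemma isClosed_bridges [Finite P] (hV : ∀ i s, IsClosed (V i s)) (i j : Fin 2) :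
    IsClosed {t | Bridges V L i j t} := by
  have e : {t | Bridges V L i j t} = ⋃ s, Prod.snd ''
      {q : (Set.Icc 0 L × Set.Icc 0 L) × ℝ | q.2 - q.1.1 ∈ V i s ∧ q.2 + q.1.2 ∈ V j s ∧
        (q.1.1 : ℝ) + q.1.2 ≤ L} := by
    ext t
    simp only [Bridges, Set.mem_ofPred_eq, Set.mem_iUnion, Set.mem_image]
    refine exists_congr fun s => ⟨?_, ?_⟩
    · rintro ⟨u, hu, v, hv, h1, h2, h3⟩
      refine ⟨((⟨t - u, by constructor <;> linarith⟩, ⟨v - t, by constructor <;> linarith⟩), t),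
        ⟨by simpa using hu, by simpa using hv, by simp only; linarith⟩, rfl⟩
    · rintro ⟨⟨⟨a, b⟩, t⟩, ⟨h1, h2, h3⟩, rfl⟩
      have ha := a.2.1
      have hb := b.2.1
      exact ⟨_, h1, _, h2, by simp only; linarith, by simp only; linarith,
        by simp only at h3 ⊢; linarith⟩
  rw [e]
  refine isClosed_iUnion_of_finite fun s => isClosedMap_snd_of_compactSpace _ ?_
  refine IsClosed.inter ?_ (IsClosed.inter ?_ ?_)
  · exact (hV i s).preimage (by fun_prop)
  · exact (hV j s).preimage (by fun_prop)
  · exact isClosed_le (f := fun q : (Set.Icc 0 L × Set.Icc 0 L) × ℝ => (q.1.1 : ℝ) + q.1.2)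
      (g := fun _ => L) (by fun_prop) (by fun_prop)

/-- Without bridges from `i` to `j`, a site visited by `i` is never visited by `j` afterwards. Hence
each site is eventually left to a single robot, and bridges from `j` to `i` cease too. -/
lemma exists_not_bridges [Finite P] [Nonempty P] (hV : ∀ i s, IsClosed (V i s)) (hL : 0 ≤ L)
    (hwin : ∀ s c, 0 ≤ c → ∃ t ∈ Set.Icc c (c + L), ∃ i, t ∈ V i s) {i j : Fin 2} (hij : i ≠ j)
    (hno : ∀ t, L ≤ t → ¬ Bridges V L i j t) : ∃ t, L ≤ t ∧ ¬ Bridges V L j i t := by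
  have hsep : ∀ s u v, L ≤ u → u ≤ v → u ∈ V i s → v ∉ V j s := by
    intro s u v hu huv hui hvj
    obtain ⟨u', ⟨hu'i, hu'⟩, hmax⟩ := (isCompact_Icc.inter_left (hV i s)).exists_isGreatest
      ⟨u, hui, Set.left_mem_Icc.2 huv⟩
    obtain ⟨v', ⟨hv'j, hv'⟩, hmin⟩ := (isCompact_Icc.inter_left (hV j s)).exists_isLeast
      ⟨v, hvj, Set.right_mem_Icc.2 hu'.2⟩
    rcases le_or_gt v' (u' + L) with h | h
    · exact hno u' (hu.trans hu'.1) ⟨s, u', hu'i, v', hv'j, le_rfl, hv'.1, h⟩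
    -- The window of length `L` centred in `[u', v']` lies strictly inside it, so a visit there
    -- contradicts the choice of `u'` or `v'`.
    obtain ⟨w, ⟨hw1, hw2⟩, l, hl⟩ := hwin s (u' + (v' - u' - L) / 2) (by linarith [hu'.1])
    have hlij : l = i ∨ l = j := by omega
    rcases hlij with rfl | rfl
    · have := hmax ⟨hl, by linarith [hu'.1], by linarith [hv'.2]⟩
      linarith
    · have := hmin ⟨hl, by linarith, by linarith [hv'.2]⟩
      linarith
  have hM : ∀ s, ∃ M, L ≤ M ∧ ((∀ v, M ≤ v → v ∉ V i s) ∨ ∀ v, M ≤ v → v ∉ V j s) := by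
    intro s
    by_cases h : ∃ u, L ≤ u ∧ u ∈ V i s
    · obtain ⟨u, hu, hui⟩ := h
      exact ⟨u, hu, Or.inr fun v hv => hsep s u v hu hv hui⟩
    · push Not at h
      exact ⟨L, le_rfl, Or.inl h⟩
  choose M hML hM using hM
  obtain ⟨B, hB⟩ := (Set.finite_range M).bddAbove
  have hB' : ∀ s, M s ≤ B := fun s => hB ⟨s, rfl⟩
  refine ⟨B + L, ?_, ?_⟩
  · linarith [hML (Classical.arbitrary P), hB' (Classical.arbitrary P)]
  · rintro ⟨s, u, hu, v, hv, h1, h2, h3⟩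
    rcases hM s with h | h
    · exact h v (by linarith [hB' s]) hv
    · exact h u (by linarith [hB' s]) hu

/-- Otherwise each time in `[L, ∞)` has bridges in exactly one direction. Two disjoint closed sets
then cover a connected ray, so one direction never occurs there, contrary to `exists_not_bridges`.
-/
lemma exists_bridges_iff [Finite P] [Nonempty P] (hV : ∀ i s, IsClosed (V i s)) (hL : 0 ≤ L)
    (hwin : ∀ s c, 0 ≤ c → ∃ t ∈ Set.Icc c (c + L), ∃ i, t ∈ V i s) :
    ∃ t, L ≤ t ∧ (Bridges V L 0 1 t ↔ Bridges V L 1 0 t) := by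
  by_contra! hcon
  have hcover : Set.Ici L ⊆ {t | Bridges V L 0 1 t} ∪ {t | Bridges V L 1 0 t} := by
    intro t ht
    have := hcon t ht
    simp only [Set.mem_union, Set.mem_ofPred_eq]
    tauto
  have h01 : ∃ t, L ≤ t ∧ Bridges V L 0 1 t := by
    by_contra! h
    obtain ⟨t, ht, hn⟩ := exists_not_bridges hV hL hwin (i := 0) (j := 1) (by decide) h
    have := hcon t ht
    have := h t ht
    tauto
  have h10 : ∃ t, L ≤ t ∧ Bridges V L 1 0 t := by
    by_contra! h
    obtain ⟨t, ht, hn⟩ := exists_not_bridges hV hL hwin (i := 1) (j := 0) (by decide) h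
    have := hcon t ht
    have := h t ht
    tauto
  obtain ⟨a, ha, ha'⟩ := h01
  obtain ⟨b, hb, hb'⟩ := h10
  obtain ⟨t, ht, h1, h2⟩ := isPreconnected_closed_iff.1 isPreconnected_Ici _ _
    (isClosed_bridges hV 0 1) (isClosed_bridges hV 1 0) hcover ⟨a, ha, ha'⟩ ⟨b, hb, hb'⟩
  have := hcon t ht
  simp only [Set.mem_ofPred_eq] at h1 h2
  tauto

/-- Take the last visit up to `t` and the first one from `t` on: a gap longer than `L` would contain
a whole window. -/
lemma exists_visits_around (hV : ∀ i s, IsClosed (V i s)) (hL : 0 ≤ L)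
    (hwin : ∀ s c, 0 ≤ c → ∃ t ∈ Set.Icc c (c + L), ∃ i, t ∈ V i s) {t : ℝ} (ht : L ≤ t) (s : P) :
    ∃ i j, ∃ u ∈ V i s, ∃ v ∈ V j s, u ≤ t ∧ t ≤ v ∧ v ≤ u + L := by
  have hcl : IsClosed (⋃ i, V i s) := isClosed_iUnion_of_finite fun i => hV i s
  have hwin' : ∀ c, 0 ≤ c → ∃ t, t ∈ ⋃ i, V i s ∧ t ∈ Set.Icc c (c + L) := fun c hc => by
    obtain ⟨t, h1, i, h2⟩ := hwin s c hc
    exact ⟨t, Set.mem_iUnion.2 ⟨i, h2⟩, h1⟩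
  obtain ⟨u, ⟨hu, hut⟩, hmax⟩ := (isCompact_Icc.inter_left hcl).exists_isGreatest
    (hwin' (t - L) (by linarith))
  obtain ⟨v, ⟨hv, hvt⟩, hmin⟩ := (isCompact_Icc.inter_left hcl).exists_isLeast
    (hwin' t (by linarith))
  obtain ⟨i, hi⟩ := Set.mem_iUnion.1 hu
  obtain ⟨j, hj⟩ := Set.mem_iUnion.1 hv
  refine ⟨i, j, u, hi, v, hj, by linarith [hut.2], hvt.1, ?_⟩
  by_contra! h
  obtain ⟨w, hw, hw1, hw2⟩ := hwin' (u + (v - u - L) / 2) (by linarith [hut.1])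
  rcases le_total w t with h' | h'
  · have := hmax ⟨hw, by linarith [hut.1], by linarith⟩
    linarith
  · have := hmin ⟨hw, h', by linarith [hvt.2]⟩
    linarith

end Visits

/-! ### From closed walks to tours. -/

section ClosedWalks

variable {P : Type*} [MetricSpace P]

/-- A robot that is at the same site at the times `a` and `b` traverses a closed tour of the sites
visited in between. -/
lemma exists_tour_of_closed_walk [Finite P] {W : P → Set ℝ}
    (hlip : ∀ s s' u v, u ∈ W s → v ∈ W s' → u ≤ v → dist s s' ≤ v - u) {a b : ℝ}
    (hab : a = b ∨ ∃ s, a ∈ W s ∧ b ∈ W s) {A : Set P} (hA : A.Nonempty)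
    (hAW : ∀ x ∈ A, ∃ t ∈ W x, a ≤ t ∧ t ≤ b) : ∃ T : Tour A, T.length ≤ b - a := by
  classical
  choose! τ hτ using hAW
  refine Tour.exists_length_le hA τ (b - a)
    (fun x hx y hy h => hlip x y _ _ (hτ x hx).1 (hτ y hy).1 h) fun x hx y hy h => ?_
  obtain ⟨hx1, hx2, hx3⟩ := hτ x hx
  obtain ⟨hy1, hy2, hy3⟩ := hτ y hy
  rcases hab with rfl | ⟨s, hsa, hsb⟩
  · linarith [hlip x y _ _ hx1 hy1 h]
  · rw [dist_comm]
    linarith [dist_triangle y s x, hlip s x _ _ hsa hx1 hx2, hlip y s _ _ hy1 hsb hy3]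

/-- Two robots that exchange their sites jointly traverse a closed tour. -/
lemma exists_tour_of_exchange [Finite P] {A : Set P} {W W' : P → Set ℝ}
    (hlip : ∀ s s' u v, u ∈ W s → v ∈ W s' → u ≤ v → dist s s' ≤ v - u)
    (hlip' : ∀ s s' u v, u ∈ W' s → v ∈ W' s' → u ≤ v → dist s s' ≤ v - u)
    {a b a' b' : ℝ} (hab : a ≤ b) (hab' : a' ≤ b') {z w : P}
    (hza : a ∈ W z) (hwb : b ∈ W w) (hwa : a' ∈ W' w) (hzb : b' ∈ W' z)
    (hA : A.Nonempty)
    (hAW : ∀ x ∈ A, (∃ t ∈ W x, a ≤ t ∧ t ≤ b) ∨ ∃ t ∈ W' x, a' ≤ t ∧ t ≤ b') :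
    ∃ T : Tour A, T.length ≤ (b - a) + (b' - a') := by
  -- The second walk is delayed by `b - a'`, so that it starts at `w` just when the first one ends
  -- there.
  have hall : ∀ x ∈ A, ∃ t, (t ∈ W x ∧ a ≤ t ∧ t ≤ b) ∨
      (t - (b - a') ∈ W' x ∧ b ≤ t ∧ t ≤ b' + (b - a')) := by
    intro x hx
    rcases hAW x hx with ⟨t, h⟩ | ⟨t, h1, h2, h3⟩
    · exact ⟨t, Or.inl h⟩
    · exact ⟨t + (b - a'), Or.inr ⟨by simpa using h1, by linarith, by linarith⟩⟩
  have hfst : ∀ x t, (t ∈ W x ∧ a ≤ t ∧ t ≤ b) → dist z x ≤ t - a ∧ dist x w ≤ b - t :=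
    fun x t h => ⟨hlip _ _ _ _ hza h.1 h.2.1, hlip _ _ _ _ h.1 hwb h.2.2⟩
  have hsnd : ∀ x t, (t - (b - a') ∈ W' x ∧ b ≤ t ∧ t ≤ b' + (b - a')) →
      dist w x ≤ t - b ∧ dist x z ≤ b' + (b - a') - t := fun x t h => by
    have h1 := hlip' _ _ _ _ hwa h.1 (by linarith)
    have h2 := hlip' _ _ _ _ h.1 hzb (by linarith)
    constructor <;> linarith
  choose! τ hτ using hall
  refine Tour.exists_length_le hA τ _ (fun x hx y hy h => ?_) fun x hx y hy h => ?_
  · rcases hτ x hx with h1 | h1 <;> rcases hτ y hy with h2 | h2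
    · exact hlip _ _ _ _ h1.1 h2.1 h
    · linarith [hfst _ _ h1, hsnd _ _ h2, dist_triangle x w y]
    -- The order of the two walks leaves only the junction time, when both sites coincide with `w`.
    · have e : τ x = b := by linarith
      have e' : τ y = b := by linarith
      have h3 := (hfst _ _ h2).2
      have h4 := (hsnd _ _ h1).1
      rw [dist_comm] at h3 h4
      linarith [dist_triangle x w y]
    · linarith [hlip' _ _ _ _ h1.1 h2.1 (by linarith)]
  · have hx' : dist z x ≤ τ x - a := by
      rcases hτ x hx with h1 | h1
      · exact (hfst _ _ h1).1
      · linarith [(hsnd _ _ h1).1, hlip _ _ _ _ hza hwb hab, dist_triangle z w x]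
    have hy' : dist y z ≤ b' + (b - a') - τ y := by
      rcases hτ y hy with h1 | h1
      · linarith [(hfst _ _ h1).2, hlip' _ _ _ _ hwa hzb hab', dist_triangle y w z]
      · exact (hsnd _ _ h1).2
    rw [dist_comm]
    linarith [dist_triangle y z x]

end ClosedWalks

end Patrol

/-! ### Tours from an arbitrary schedule, and optimality. -/

namespace Patrol

/-- If every site is visited by one of two robots in every time window of length `L`, then there is
a tour of all sites of length at most `2 * L`, or the sites can be split into two groups that have
tours of length at most `L`. -/
lemma exists_tours_of_visits {P : Type*} [MetricSpace P] [Finite P] [Nonempty P]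
    {V : Fin 2 → P → Set ℝ} {L : ℝ} (hV : ∀ i s, IsClosed (V i s)) (hL : 0 ≤ L)
    (hlip : ∀ i s s' u v, u ∈ V i s → v ∈ V i s' → u ≤ v → dist s s' ≤ v - u)
    (hwin : ∀ s c, 0 ≤ c → ∃ t ∈ Set.Icc c (c + L), ∃ i, t ∈ V i s) :
    (∃ T : Tour (Set.univ : Set P), T.length ≤ 2 * L) ∨
      ∃ A : Set P, (∃ T : Tour A, T.length ≤ L) ∧ ∃ T : Tour Aᶜ, T.length ≤ L := by
  obtain ⟨t, ht, hiff⟩ := exists_bridges_iff hV hL hwin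
  choose i j u hu v hv hut htv hvu using exists_visits_around hV hL hwin ht
  have hE : ∀ a b, ∃ e : ℝ × ℝ, Bridges V L a b t →
      ∃ s, e.1 ∈ V a s ∧ e.2 ∈ V b s ∧ e.1 ≤ t ∧ t ≤ e.2 ∧ e.2 ≤ e.1 + L := by
    intro a b
    by_cases h : Bridges V L a b t
    · obtain ⟨s, u, hu, v, hv, h⟩ := h
      exact ⟨(u, v), fun _ => ⟨s, hu, hv, h⟩⟩
    · exact ⟨0, fun h' => absurd h' h⟩
  choose e he using hE
  let S : Fin 2 → Fin 2 → Set (ℝ × ℝ) := fun a b => (fun x => (u x, v x)) '' {x | i x = a ∧ j x = b}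
  -- The degenerate interval `(t, t)` keeps this family nonempty and stands for a walk of length
  -- zero. In `O`, the extra witness `e a b` makes nonemptiness equivalent to `Bridges`, even if no
  -- site's chosen interval has these labels.
  let D : Fin 2 → Set (ℝ × ℝ) := fun a => S a a ∪ {(t, t)}
  let O : Fin 2 → Fin 2 → Set (ℝ × ℝ) := fun a b => S a b ∪ {g | g = e a b ∧ Bridges V L a b t}
  have hSfin : ∀ a b, (S a b).Finite := fun a b => (Set.toFinite _).image _
  have hDfin : ∀ a, (D a).Finite := fun a => (hSfin a a).union (Set.finite_singleton _)
  have hOfin : ∀ a b, (O a b).Finite := fun a b =>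
    (hSfin a b).union ((Set.finite_singleton (e a b)).subset fun g hg => hg.1)
  have hD : ∀ a, ∀ g ∈ D a, g.1 ≤ t ∧ t ≤ g.2 ∧ g.2 ≤ g.1 + L ∧
      (g.1 = g.2 ∨ ∃ s, g.1 ∈ V a s ∧ g.2 ∈ V a s) := by
    rintro a g (⟨x, ⟨rfl, hx⟩, rfl⟩ | rfl)
    · exact ⟨hut x, htv x, hvu x, Or.inr ⟨x, hu x, hx ▸ hv x⟩⟩
    · exact ⟨le_rfl, le_rfl, by simpa using hL, Or.inl rfl⟩
  have hO : ∀ a b, ∀ g ∈ O a b, ∃ s, g.1 ∈ V a s ∧ g.2 ∈ V b s ∧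
      g.1 ≤ t ∧ t ≤ g.2 ∧ g.2 ≤ g.1 + L := by
    rintro a b g (⟨x, ⟨rfl, rfl⟩, rfl⟩ | ⟨rfl, h⟩)
    · exact ⟨x, hu x, hv x, hut x, htv x, hvu x⟩
    · exact he a b h
  have hOne : ∀ a b, (O a b).Nonempty ↔ Bridges V L a b t := fun a b => by
    constructor
    · rintro ⟨g, hg⟩
      obtain ⟨s, h1, h2, h⟩ := hO a b g hg
      exact ⟨s, g.1, h1, g.2, h2, h⟩
    · exact fun h => ⟨e a b, Or.inr ⟨rfl, h⟩⟩
  have hfin2 : ∀ a : Fin 2, a = 0 ∨ a = 1 := by decide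
  have hmem : ∀ x, (u x, v x) ∈ S (i x) (j x) := fun x => ⟨x, ⟨rfl, rfl⟩, rfl⟩
  rcases exists_covering_pair (hDfin 0) (hOfin 0 1) (hOfin 1 0) (hDfin 1) ⟨_, Or.inr rfl⟩
    ⟨_, Or.inr rfl⟩ ((hOne 0 1).trans (hiff.trans (hOne 1 0).symm)) with
    ⟨a, ha, b, hb, h00, h01, h10, h11⟩ | ⟨a, ha, b, hb, h01, h00, h11, h10⟩
  · obtain ⟨ha1, ha2, ha3, ha4⟩ := hD 0 a ha
    obtain ⟨hb1, hb2, hb3, hb4⟩ := hD 1 b hb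
    have hcov : ∀ x, (∃ r ∈ V 0 x, a.1 ≤ r ∧ r ≤ a.2) ∨ ∃ r ∈ V 1 x, b.1 ≤ r ∧ r ≤ b.2 := by
      intro x
      have hx := hmem x
      have hux := hu x
      have hvx := hv x
      have h1 := hut x
      have h2 := htv x
      rcases hfin2 (i x) with hi | hi <;> rcases hfin2 (j x) with hj | hj <;>
        rw [hi, hj] at hx <;> rw [hi] at hux <;> rw [hj] at hvx
      · exact Or.inl ((h00 _ (Or.inl hx)).elim (fun h => ⟨_, hux, h, h1.trans ha2⟩)
          fun h => ⟨_, hvx, ha1.trans h2, h⟩)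
      · exact (h01 _ (Or.inl hx)).imp (fun h => ⟨_, hux, h, h1.trans ha2⟩)
          fun h => ⟨_, hvx, hb1.trans h2, h⟩
      · exact ((h10 _ (Or.inl hx)).imp (fun h => ⟨_, hux, h, h1.trans hb2⟩)
          fun h => ⟨_, hvx, ha1.trans h2, h⟩).symm
      · exact Or.inr ((h11 _ (Or.inl hx)).elim (fun h => ⟨_, hux, h, h1.trans hb2⟩)
          fun h => ⟨_, hvx, hb1.trans h2, h⟩)
    have hloop0 : ∀ A : Set P, A.Nonempty → (∀ x ∈ A, ∃ r ∈ V 0 x, a.1 ≤ r ∧ r ≤ a.2) →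
        ∃ T : Tour A, T.length ≤ L := fun A hA hAx => by
      obtain ⟨T, hT⟩ := exists_tour_of_closed_walk (hlip 0) ha4 hA hAx
      exact ⟨T, by linarith⟩
    have hloop1 : ∀ A : Set P, A.Nonempty → (∀ x ∈ A, ∃ r ∈ V 1 x, b.1 ≤ r ∧ r ≤ b.2) →
        ∃ T : Tour A, T.length ≤ L := fun A hA hAx => by
      obtain ⟨T, hT⟩ := exists_tour_of_closed_walk (hlip 1) hb4 hA hAx
      exact ⟨T, by linarith⟩
    set A : Set P := {x | ∃ r ∈ V 0 x, a.1 ≤ r ∧ r ≤ a.2} with hAdef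
    have hAc : ∀ x ∈ Aᶜ, ∃ r ∈ V 1 x, b.1 ≤ r ∧ r ≤ b.2 := fun x hx => (hcov x).resolve_left hx
    rcases A.eq_empty_or_nonempty with hA | hA
    · obtain ⟨T, hT⟩ := hloop1 Set.univ Set.univ_nonempty fun x _ => hAc x (by simp [hA])
      exact Or.inl ⟨T, by linarith⟩
    rcases Aᶜ.eq_empty_or_nonempty with hA' | hA'
    · obtain ⟨T, hT⟩ := hloop0 Set.univ Set.univ_nonempty fun x _ => by
        have : x ∈ A := by rw [Set.compl_empty_iff.1 hA']; trivial
        exact this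
      exact Or.inl ⟨T, by linarith⟩
    exact Or.inr ⟨A, hloop0 A hA fun x hx => hx, hloop1 Aᶜ hA' hAc⟩
  · obtain ⟨z, haz, haz', ha1, ha2, ha3⟩ := hO 0 1 a ha
    obtain ⟨w, hbw, hbw', hb1, hb2, hb3⟩ := hO 1 0 b hb
    -- Robot `0` goes from `z` to `w` during `[a.1, b.2]` and robot `1` from `w` to `z` during
    -- `[b.1, a.2]`. The durations add up to `(a.2 - a.1) + (b.2 - b.1) ≤ 2 * L`.
    obtain ⟨T, hT⟩ := exists_tour_of_exchange (A := Set.univ) (hlip 0) (hlip 1) (ha1.trans hb2)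
      (hb1.trans ha2) haz hbw' hbw haz' Set.univ_nonempty fun x _ => by
      have hx := hmem x
      have hux := hu x
      have hvx := hv x
      have h1 := hut x
      have h2 := htv x
      rcases hfin2 (i x) with hi | hi <;> rcases hfin2 (j x) with hj | hj <;>
        rw [hi, hj] at hx <;> rw [hi] at hux <;> rw [hj] at hvx
      · exact Or.inl ((h00 _ (Or.inl hx)).elim (fun h => ⟨_, hux, h, h1.trans hb2⟩)
          fun h => ⟨_, hvx, ha1.trans h2, h⟩)
      · exact (h01 _ (Or.inl hx)).imp (fun h => ⟨_, hux, h, h1.trans hb2⟩)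
          fun h => ⟨_, hvx, hb1.trans h2, h⟩
      · exact ((h10 _ (Or.inl hx)).imp (fun h => ⟨_, hux, h, h1.trans ha2⟩)
          fun h => ⟨_, hvx, ha1.trans h2, h⟩).symm
      · exact Or.inr ((h11 _ (Or.inl hx)).elim (fun h => ⟨_, hux, h, h1.trans ha2⟩)
          fun h => ⟨_, hvx, hb1.trans h2, h⟩)
    exact Or.inl ⟨T, by linarith⟩

open Classical in
/-- The latency of the best cyclic solution for two robots with the groups `A` and `Aᶜ`, or with a
single group if one of these sets is empty. -/
noncomputable def cyclicLatency {P : Type*} [MetricSpace P] (A : Set P) : ℝ :=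
  if A.Nonempty ∧ Aᶜ.Nonempty then max (tspLength A) (tspLength Aᶜ)
  else tspLength (Set.univ : Set P) / 2

section

variable {P : Type*} [MetricSpace P] [Finite P] [Nonempty P]

lemma exists_cyclic_latency_le (A : Set P) :
    ∃ σ : PatrolSchedule 2 P, IsCyclic σ ∧ latency σ ≤ ENNReal.ofReal (cyclicLatency A) := by
  unfold cyclicLatency
  split_ifs with h
  · exact exists_cyclic_two_groups h.1 h.2
  · exact exists_cyclic_one_group

lemma exists_cyclicLatency_le (τ : PatrolSchedule 2 P) :
    ∃ A : Set P, ENNReal.ofReal (cyclicLatency A) ≤ latency τ := by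
  rcases eq_or_ne (latency τ) ⊤ with h | h
  · exact ⟨∅, h ▸ le_top⟩
  have hL := ENNReal.toReal_nonneg (a := latency τ)
  have hle : latency τ ≤ ENNReal.ofReal (latency τ).toReal := (ENNReal.ofReal_toReal h).ge
  rcases exists_tours_of_visits (V := fun i s => {t | (τ i).IsAt t s})
    (fun i s => (τ i).isClosed_isAt s) hL (fun i s s' u v hu hv => hu.dist_le hv)
    (fun s c hc => exists_visited_mem_Icc hL hle s hc) with ⟨T, hT⟩ | ⟨A, ⟨T, hT⟩, T', hT'⟩
  · refine ⟨∅, ENNReal.ofReal_le_of_le_toReal ?_⟩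
    simp only [cyclicLatency, Set.not_nonempty_empty, false_and, if_false]
    linarith [tspLength_le T]
  · refine ⟨A, ENNReal.ofReal_le_of_le_toReal ?_⟩
    rw [cyclicLatency, if_pos ⟨T.nonempty, T'.nonempty⟩]
    exact max_le ((tspLength_le T).trans hT) ((tspLength_le T').trans hT')

end

end Patrol

theorem mainTheorem3 {P : Type*} [MetricSpace P] [Finite P] [Nonempty P] :
    (∃ σ : Patrol.PatrolSchedule 2 P, Patrol.IsOptimalCyclic σ) ∧
      ∀ σ : Patrol.PatrolSchedule 2 P, Patrol.IsOptimalCyclic σ → Patrol.IsOptimal σ := by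
  obtain ⟨A, hA⟩ := Finite.exists_min (Patrol.cyclicLatency (P := P))
  obtain ⟨σ, hcyc, hσ⟩ := Patrol.exists_cyclic_latency_le A
  have hopt : Patrol.IsOptimal σ := fun τ => by
    obtain ⟨B, hB⟩ := Patrol.exists_cyclicLatency_le τ
    exact (hσ.trans (ENNReal.ofReal_le_ofReal (hA B))).trans hB
  exact ⟨⟨σ, hcyc, fun σ' _ => hopt σ'⟩, fun σ' h τ => (h.2 σ hcyc).trans (hopt τ)⟩
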